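/- For a multi-index $\alpha=(\alpha_1,\dots,\alpha_m)\in\mathbb{N}^m$ (with $0\in\mathbb N$) put $|\alpha|=\sum_i\alpha_i$ and, for $z\in\mathbb{C}^m$, $z^\alpha=\prod_i z_i^{\alpha_i}$; for an integer $k$ let $\Delta_k=\{\alpha\in\mathbb{N}^m: |\alpha|\le k\}$ (so $\Delta_{-1}=\emptyset$). Points $y_1,\dots,y_r\in\mathbb{C}^m$ are called $D$-independent, for a finite set $D\subset\mathbb{N}^m$, if the matrix $[\,y_k^{\alpha}\,]_{\alpha\in D,\,1\le k\le r}$ has rank $r$. The nuclear norm $\|X\|_*$ of a complex matrix $X$ is the sum of its singular values. Let $A=\Delta_d$ with $d\ge 1$, and $2A=A+A=\Delta_{2d}$. Given values $h=(h_\alpha)_{\alpha\in A}$ in $\mathbb{C}$, nuclear norm minimization for the quasi-Hankel completion problem is $$\min_{(h_\alpha)_{\alpha\in 2A\setminus A}\in\,\mathbb{C}^{2A\setminus A}}\ \bigl\|\,[\,h_{\alpha+\beta}\,]_{\alpha,\beta\in A}\bigr\|_* .$$ **Theorem.** Let $d''=\lfloor (d-1)/2\rfloor$ and $r\le\binom{m+d''}{m}$.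 Let $y_1,\dots,y_r\in\mathbb{C}^m$ be points for which there are an integer $d_0$ with $0\le d_0\le d-1$ and a set $D$ of exactly $r$ multi-indices with $\Delta_{d_0-1}\subseteq D\subseteq\Delta_{d_0}$ such that $y_1,\dots,y_r$ are $D$-independent. Then there is a constant $\rho_0>0$ (depending on $m$, $d$ and the points $y_k$ only) such that for every real $\rho$ with $0<\rho<\rho_0$ and all nonzero $c_1,\dots,c_r\in\mathbb{C}$ the following holds. For the known values $h_\alpha=\sum_{k=1}^r c_k(\rho y_k)^\alpha$, $\alpha\in A$, the nuclear norm minimization problem has exactly one solution, namely the canonical completion $h_\alpha=\sum_{k=1}^r c_k(\rho y_k)^\alpha$, $\alpha\in 2A\setminus A$. -/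

import Mathlib

open scoped Pointwise

noncomputable section

namespace QHankel

/-- Total degree of a multi-index. -/
def deg {m : ℕ} (α : Fin m → ℕ) : ℕ := ∑ i, α i

/-- The set of multi-indices in `ℕ^m` of total degree at most `d`. -/
def trgset (m d : ℕ) : Finset (Fin m → ℕ) :=
  (Fintype.piFinset fun _ : Fin m => Finset.range (d + 1)).filter fun α => deg α ≤ d

theorem mem_trgset {m d : ℕ} {α : Fin m → ℕ} : α ∈ trgset m d ↔ deg α ≤ d := by
  constructor
  · intro h
    exact (Finset.mem_filter.mp h).2
  · intro h
    refine Finset.mem_filter.mpr ⟨Fintype.mem_piFinset.mpr fun i => ?_, h⟩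
    have h1 : α i ≤ deg α := Finset.single_le_sum (fun _ _ => Nat.zero_le _) (Finset.mem_univ i)
    exact Finset.mem_range.mpr (by omega)

/-- The monomial `z^α`. -/
def monom {m : ℕ} (z : Fin m → ℂ) (α : Fin m → ℕ) : ℂ := ∏ i, z i ^ α i

/-- The quasi-Vandermonde matrix with rows indexed by `A` and columns indexed by the points. -/
def vandermonde {m r : ℕ} (A : Finset (Fin m → ℕ)) (z : Fin r → Fin m → ℂ) :
    Matrix A (Fin r) ℂ :=
  Matrix.of fun α k => monom (z k) α

/-- The points `z_1, …, z_r` are `A`-independent. -/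
def IsIndependent {m r : ℕ} (A : Finset (Fin m → ℕ)) (z : Fin r → Fin m → ℂ) : Prop :=
  (vandermonde A z).rank = r

/-- The quasi-Hankel matrix `[h_{α + β}]`, `α, β ∈ A`, of an array `h` indexed by `2A = A + A`. -/
def hankel {m : ℕ} (A : Finset (Fin m → ℕ)) (h : ↥(A + A) → ℂ) : Matrix A A ℂ :=
  Matrix.of fun α β => h ⟨α.1 + β.1, Finset.add_mem_add α.2 β.2⟩

/-- The array indexed by `2A` whose entries on `A` are the known values `h` and whose entries on
`2A \ A` are the unknowns `p`. -/
def fillIn {m : ℕ} {A : Finset (Fin m → ℕ)} (h : A → ℂ) (p : ↥((A + A) \ A) → ℂ) :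
    ↥(A + A) → ℂ :=
  fun α => if hα : α.1 ∈ A then h ⟨α.1, hα⟩ else p ⟨α.1, Finset.mem_sdiff.mpr ⟨α.2, hα⟩⟩

/-- The affine matrix structure of the quasi-Hankel completion problem with known values `h`. -/
def completion {m : ℕ} {A : Finset (Fin m → ℕ)} (h : A → ℂ) (p : ↥((A + A) \ A) → ℂ) :
    Matrix A A ℂ :=
  hankel A (fillIn h p)

/-- The nuclear norm of a square complex matrix: the sum of its singular values. -/
def nuclearNorm {ι : Type*} [Fintype ι] [DecidableEq ι] (M : Matrix ι ι ℂ) : ℝ :=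
  ∑ i ∈ Finset.range (Fintype.card ι), (Matrix.toEuclideanLin M).singularValues i

/-- The set of solutions of nuclear norm minimization over all completions of `h`. -/
def nuclearNormSolutions {m : ℕ} {A : Finset (Fin m → ℕ)} (h : A → ℂ) :
    Set (↥((A + A) \ A) → ℂ) :=
  {p | ∀ q, nuclearNorm (completion h p) ≤ nuclearNorm (completion h q)}

/-- The array `h_α = ∑ c_k z_k^α`, for all multi-indices `α`. -/
def expArray {m r : ℕ} (c : Fin r → ℂ) (z : Fin r → Fin m → ℂ) (α : Fin m → ℕ) : ℂ :=
  ∑ k, c k * monom (z k) α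

/-- The known values on `A` of the array `h_α = ∑ c_k z_k^α`. -/
def initialArray {m r : ℕ} (A : Finset (Fin m → ℕ)) (c : Fin r → ℂ) (z : Fin r → Fin m → ℂ) :
    A → ℂ :=
  fun α => expArray c z α.1

/-- The canonical completion: the same formula on the unknown positions `2A \ A`. -/
def canonicalCompletion {m r : ℕ} (A : Finset (Fin m → ℕ)) (c : Fin r → ℂ)
    (z : Fin r → Fin m → ℂ) : ↥((A + A) \ A) → ℂ :=
  fun α => expArray c z α.1

end QHankel

end

/-! ### Duality and perturbation of the nuclear norm for operators. -/

section NuclearNorm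

open Module InnerProductSpace

variable {V : Type*} [NormedAddCommGroup V] [InnerProductSpace ℂ V] [FiniteDimensional ℂ V]

/-! Let `X` be the canonical completion, `E` its difference from another completion, `k = (d - 1) /
2`. Since `2k < d`, `E` vanishes on rows and columns of degree at most `k`. The cardinality bound
forces `D` into these degrees, so on the column space of `X` the coordinates of degree above `k` are
O(ρ), uniformly in `c` (`IsIndependent.exists_high_coord_le`); by symmetry of `X`, so they are on
the row space. Hence `E` is O(ρ) times its largest entry on range × row space, while that entry,
which can be placed where both degrees exceed `k`, almost survives projection to the orthogonal
complements. Pairing `X + E` with a contraction, the polar part of `X` plus a rank-one term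
detecting this entry, gives a strictly larger nuclear norm (`LinearMap.sum_singularValues_lt_add`,
`nuclearNorm_lt_add`). -/

/-- An orthonormal basis of right singular vectors. -/
theorem LinearMap.exists_rightSingularBasis (T : V →ₗ[ℂ] V) {n : ℕ} (hn : finrank ℂ V = n) :
    ∃ b : OrthonormalBasis (Fin n) ℂ V, ∀ i,
      LinearMap.adjoint T (T (b i)) = ((T.singularValues i : ℂ) ^ 2) • b i := by
  refine ⟨T.isSymmetric_adjoint_comp_self.eigenvectorBasis hn, fun i => ?_⟩
  have h := T.isSymmetric_adjoint_comp_self.apply_eigenvectorBasis hn i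
  rw [← T.sq_singularValues_fin hn i] at h
  exact h.trans (congrArg (· • _) (Complex.ofReal_pow _ _))

theorem LinearMap.inner_map_rightSingular (T : V →ₗ[ℂ] V) {n : ℕ}
    {b : OrthonormalBasis (Fin n) ℂ V}
    (hb : ∀ i, LinearMap.adjoint T (T (b i)) = ((T.singularValues i : ℂ) ^ 2) • b i)
    (i j : Fin n) :
    ⟪T (b i), T (b j)⟫_ℂ = if i = j then (T.singularValues j : ℂ) ^ 2 else 0 := by
  rw [← LinearMap.adjoint_inner_right, hb, inner_smul_right, b.inner_eq_ite]
  split_ifs <;> simp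

theorem LinearMap.norm_map_rightSingular (T : V →ₗ[ℂ] V) {n : ℕ}
    {b : OrthonormalBasis (Fin n) ℂ V}
    (hb : ∀ i, LinearMap.adjoint T (T (b i)) = ((T.singularValues i : ℂ) ^ 2) • b i)
    (i : Fin n) : ‖T (b i)‖ = T.singularValues i := by
  have h := T.inner_map_rightSingular hb i i
  rw [if_pos rfl, inner_self_eq_norm_sq_to_K] at h
  have h2 : ‖T (b i)‖ ^ 2 = T.singularValues i ^ 2 :=
    Complex.ofReal_injective (by push_cast; exact h)
  exact (sq_eq_sq₀ (norm_nonneg _) (T.singularValues_nonneg _)).1 h2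

/-- The trace makes the pairing basis-free, so it can be moved to the right singular basis of `T`.
-/
theorem LinearMap.sum_inner_eq_trace {ι : Type*} [Fintype ι] (W T : V →ₗ[ℂ] V)
    (b : OrthonormalBasis ι ℂ V) :
    ∑ i, ⟪W (b i), T (b i)⟫_ℂ = LinearMap.trace ℂ V (LinearMap.adjoint W ∘ₗ T) := by
  rw [LinearMap.trace_eq_sum_inner _ b]
  simp [LinearMap.adjoint_inner_right]

/-- Duality of the nuclear norm and the operator norm. -/
theorem LinearMap.re_sum_inner_le_sum_singularValues {ι : Type*} [Fintype ι] (W T : V →ₗ[ℂ] V)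
    (hW : ∀ v, ‖W v‖ ≤ ‖v‖) (b : OrthonormalBasis ι ℂ V) {n : ℕ} (hn : finrank ℂ V = n) :
    (∑ i, ⟪W (b i), T (b i)⟫_ℂ).re ≤ ∑ i : Fin n, T.singularValues i := by
  obtain ⟨b', hb'⟩ := T.exists_rightSingularBasis hn
  rw [W.sum_inner_eq_trace T b, ← W.sum_inner_eq_trace T b', Complex.re_sum]
  refine Finset.sum_le_sum fun i _ => ?_
  calc _ ≤ ‖⟪W (b' i), T (b' i)⟫_ℂ‖ := Complex.re_le_norm _
    _ ≤ ‖W (b' i)‖ * ‖T (b' i)‖ := norm_inner_le_norm _ _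
    _ ≤ 1 * ‖T (b' i)‖ := by
      gcongr
      simpa using hW (b' i)
    _ = _ := by rw [one_mul, T.norm_map_rightSingular hb']

/-- The nuclear norm strictly increases along a direction `E` which is small on
`range X × (ker X)ᗮ` compared with its size on `(range X)ᗮ × ker X`. -/
theorem LinearMap.sum_singularValues_lt_add (X E : V →ₗ[ℂ] V) {n : ℕ} (hn : finrank ℂ V = n)
    {a b : V} (ha : ‖a‖ ≤ 1) (hb : ‖b‖ ≤ 1) (haX : ∀ v, ⟪a, X v⟫_ℂ = 0) (hbX : X b = 0)
    {δ : ℝ} (hδ : 0 ≤ δ)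
    (hE : ∀ u ∈ LinearMap.range X, ∀ v ∈ (LinearMap.ker X)ᗮ, ‖⟪u, E v⟫_ℂ‖ ≤ δ * ‖u‖ * ‖v‖)
    (hab : n * δ < ‖⟪a, E b⟫_ℂ‖) :
    ∑ i : Fin n, X.singularValues i < ∑ i : Fin n, (X + E).singularValues i := by
  obtain ⟨f, hf⟩ := X.exists_rightSingularBasis hn
  set σ : Fin n → ℝ := fun i => X.singularValues i with hσ
  have hσX : ∀ i, ‖X (f i)‖ = σ i := X.norm_map_rightSingular hf
  -- Left singular vectors; where `σ i = 0`, the convention `0⁻¹ = 0` gives `w i = 0`.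
  set w : Fin n → V := fun i => ((σ i : ℂ)⁻¹) • X (f i) with hw
  have hw1 : ∀ i, ‖w i‖ ≤ 1 := fun i => by
    rw [hw, norm_smul, norm_inv, hσX, Complex.norm_real, Real.norm_eq_abs,
      abs_of_nonneg (X.singularValues_nonneg i)]
    exact inv_mul_le_one
  have hwr : ∀ i, w i ∈ LinearMap.range X := fun i => ⟨((σ i : ℂ)⁻¹) • f i, by simp [hw]⟩
  have hfk : ∀ i, σ i ≠ 0 → f i ∈ (LinearMap.ker X)ᗮ := fun i hi => by
    rw [Submodule.mem_orthogonal']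
    intro v hv
    have h : ⟪LinearMap.adjoint X (X (f i)), v⟫_ℂ = 0 := by
      rw [LinearMap.adjoint_inner_left, LinearMap.mem_ker.1 hv, inner_zero_right]
    rw [hf, inner_smul_left] at h
    refine (mul_eq_zero.1 h).resolve_left ?_
    have : (σ i : ℂ) ≠ 0 := by exact_mod_cast hi
    simpa using this
  have hww : ∀ i j, i ≠ j → ⟪w i, w j⟫_ℂ = 0 := fun i j hij => by
    simp [hw, X.inner_map_rightSingular hf, hij]
  -- A phase making the rank-one contribution real and nonnegative.
  obtain ⟨θ, hθ, hθE⟩ : ∃ θ : ℂ, ‖θ‖ ≤ 1 ∧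
      (starRingEnd ℂ) θ * ⟪a, E b⟫_ℂ = (‖⟪a, E b⟫_ℂ‖ : ℂ) := by
    set z := ⟪a, E b⟫_ℂ
    refine ⟨z / ‖z‖, ?_, ?_⟩
    · rw [norm_div]
      simpa using div_self_le_one ‖z‖
    · by_cases hz : z = 0
      · simp [hz]
      have : (‖z‖ : ℂ) ≠ 0 := by simpa using hz
      rw [map_div₀, Complex.conj_ofReal, div_mul_eq_mul_div, Complex.conj_mul', sq, mul_div_assoc,
        div_self this, mul_one]
  -- `W₁` is the partial isometry in the polar decomposition of `X`.
  let W₁ : V →ₗ[ℂ] V := ∑ i, (innerₛₗ ℂ (f i)).smulRight (w i)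
  have hW₁ : ∀ v, W₁ v = ∑ i, ⟪f i, v⟫_ℂ • w i := fun v => by simp [W₁]
  let W : V →ₗ[ℂ] V := W₁ + (innerₛₗ ℂ b).smulRight (θ • a)
  have hW : ∀ v, W v = W₁ v + ⟪b, v⟫_ℂ • θ • a := fun v => by simp [W]
  have hW₁n : ∀ v, ‖W₁ v‖ ≤ ‖v‖ := fun v => by
    refine le_of_sq_le_sq ?_ (norm_nonneg _)
    have h1 : ((‖W₁ v‖ ^ 2 : ℝ) : ℂ) = ((∑ i, ‖⟪f i, v⟫_ℂ‖ ^ 2 * ‖w i‖ ^ 2 : ℝ) : ℂ) := by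
      push_cast
      refine (inner_self_eq_norm_sq_to_K (𝕜 := ℂ) (W₁ v)).symm.trans ?_
      rw [hW₁, sum_inner]
      refine Finset.sum_congr rfl fun i _ => ?_
      rw [inner_sum, Finset.sum_eq_single i]
      · rw [inner_smul_left, inner_smul_right, ← mul_assoc, Complex.conj_mul',
          inner_self_eq_norm_sq_to_K]
        rfl
      · intro j _ hj
        rw [inner_smul_left, inner_smul_right, hww i j hj.symm]
        simp
      · simp
    rw [Complex.ofReal_inj.1 h1, ← f.sum_sq_norm_inner_right v]
    refine Finset.sum_le_sum fun i _ => ?_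
    exact mul_le_of_le_one_right (sq_nonneg _) (pow_le_one₀ (norm_nonneg _) (hw1 i))
  have hW₁k : ∀ v ∈ LinearMap.ker X, W₁ v = 0 := fun v hv => by
    rw [hW₁]
    refine Finset.sum_eq_zero fun i _ => ?_
    by_cases hi : σ i = 0
    · simp [hw, hi]
    · rw [(Submodule.mem_orthogonal' _ _).1 (hfk i hi) v hv, zero_smul]
  -- `W₁` sees only the component in `(ker X)ᗮ`, the rank-one term only that in `ker X`, and their
  -- images are orthogonal: Pythagoras.
  have hWn : ∀ v, ‖W v‖ ≤ ‖v‖ := fun v => by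
    refine le_of_sq_le_sq ?_ (norm_nonneg _)
    obtain ⟨k, hk, l, hl, rfl⟩ := (LinearMap.ker X).exists_add_mem_mem_orthogonal v
    have hbl : ⟪b, l⟫_ℂ = 0 := (Submodule.mem_orthogonal _ _).1 hl b hbX
    have hkl : ⟪k, l⟫_ℂ = 0 := (Submodule.mem_orthogonal _ _).1 hl k hk
    have hWv : W (k + l) = W₁ l + ⟪b, k⟫_ℂ • θ • a := by
      rw [hW, map_add, hW₁k k hk, inner_add_right, hbl, zero_add, add_zero]
    have horth : ⟪W₁ l, ⟪b, k⟫_ℂ • θ • a⟫_ℂ = 0 := by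
      rw [inner_smul_right, inner_smul_right, ← inner_conj_symm (W₁ l), hW₁, inner_sum]
      have : ∑ i, ⟪a, ⟪f i, l⟫_ℂ • w i⟫_ℂ = 0 :=
        Finset.sum_eq_zero fun i _ => by simp [hw, haX]
      simp [this]
    have e1 := norm_add_sq_eq_norm_sq_add_norm_sq_of_inner_eq_zero _ _ horth
    have e2 := norm_add_sq_eq_norm_sq_add_norm_sq_of_inner_eq_zero _ _ hkl
    have h3 : ‖⟪b, k⟫_ℂ • θ • a‖ ≤ ‖k‖ := by
      rw [norm_smul, norm_smul]
      calc _ ≤ (‖b‖ * ‖k‖) * (1 * 1) := by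
            gcongr
            exact norm_inner_le_norm _ _
        _ ≤ (1 * ‖k‖) * (1 * 1) := by gcongr
        _ = ‖k‖ := by ring
    rw [hWv, sq, sq, e1, e2]
    have := hW₁n l
    nlinarith [norm_nonneg (W₁ l), norm_nonneg (⟪b, k⟫_ℂ • θ • a)]
  refine lt_of_lt_of_le ?_ (W.re_sum_inner_le_sum_singularValues (X + E) hWn f hn)
  have hWf : ∀ i, W (f i) = w i + ⟪b, f i⟫_ℂ • θ • a := fun i => by
    rw [hW, hW₁, Finset.sum_eq_single i]
    · simp
    · intro j _ hj
      rw [f.inner_eq_ite, if_neg hj, zero_smul]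
    · simp
  have hterm : ∀ i, ⟪W (f i), (X + E) (f i)⟫_ℂ = (σ i : ℂ) + ⟪w i, E (f i)⟫_ℂ +
      (starRingEnd ℂ) θ * (⟪f i, b⟫_ℂ * ⟪a, E (f i)⟫_ℂ) := fun i => by
    have h1 : ⟪w i, X (f i)⟫_ℂ = (σ i : ℂ) := by
      rw [hw, inner_smul_left, X.inner_map_rightSingular hf, if_pos rfl]
      by_cases hi : (σ i : ℂ) = 0
      · have : ((X.singularValues i : ℝ) : ℂ) = 0 := hi
        simp [hi, this]
      · rw [map_inv₀, Complex.conj_ofReal, sq, ← mul_assoc, inv_mul_cancel₀ hi, one_mul]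
    rw [hWf, inner_add_left, LinearMap.add_apply, inner_add_right (w i), h1,
      inner_smul_left (θ • a), inner_smul_left a, inner_conj_symm, inner_add_right a, haX, zero_add]
    ring
  have hEb : ∑ i, ⟪f i, b⟫_ℂ * ⟪a, E (f i)⟫_ℂ = ⟪a, E b⟫_ℂ := by
    conv_rhs => rw [← f.sum_repr' b]
    simp
  have hsmall : ∀ i, -δ ≤ (⟪w i, E (f i)⟫_ℂ).re := fun i => by
    by_cases hi : σ i = 0
    · simp [hw, hi, hδ]
    · have h1 := hE _ (hwr i) _ (hfk i hi)
      have h2 : δ * ‖w i‖ * ‖f i‖ ≤ δ := by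
        rw [f.norm_eq_one, mul_one]
        exact mul_le_of_le_one_right hδ (hw1 i)
      have h3 := Complex.abs_re_le_norm ⟪w i, E (f i)⟫_ℂ
      linarith [neg_abs_le (⟪w i, E (f i)⟫_ℂ).re]
  simp_rw [hterm]
  rw [Finset.sum_add_distrib, ← Finset.mul_sum, hEb, hθE, Finset.sum_add_distrib, Complex.add_re,
    Complex.add_re, Complex.ofReal_re, Complex.re_sum, Complex.re_sum]
  simp only [Complex.ofReal_re]
  have h4 : ∑ _i : Fin n, -δ ≤ ∑ i, (⟪w i, E (f i)⟫_ℂ).re := Finset.sum_le_sum fun i _ => hsmall i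
  rw [Finset.sum_const, Finset.card_univ, Fintype.card_fin, nsmul_eq_mul] at h4
  linarith

end NuclearNorm

/-! ### Coordinate estimates and the matrix form of the perturbation bound. -/

section Matrices

open Module InnerProductSpace

variable {ι : Type*} [Fintype ι] [DecidableEq ι]

theorem QHankel.nuclearNorm_eq_sum_fin (M : Matrix ι ι ℂ) :
    QHankel.nuclearNorm M =
      ∑ i : Fin (Fintype.card ι), (Matrix.toEuclideanLin M).singularValues i := by
  rw [QHankel.nuclearNorm, Finset.sum_range]

theorem Matrix.inner_toEuclideanLin (M : Matrix ι ι ℂ) (u v : EuclideanSpace ℂ ι) :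
    ⟪u, Matrix.toEuclideanLin M v⟫_ℂ = ∑ i, ∑ j, (starRingEnd ℂ) (u i) * M i j * v j := by
  simp only [PiLp.inner_apply, Matrix.toLpLin_apply, Matrix.mulVec, dotProduct, RCLike.inner_apply,
    Finset.sum_mul]
  refine Finset.sum_congr rfl fun i _ => Finset.sum_congr rfl fun j _ => ?_
  ring

theorem EuclideanSpace.norm_coord_le {ι : Type*} [Fintype ι] (u : EuclideanSpace ℂ ι) (i : ι) : ‖u i‖ ≤ ‖u‖ :=
  PiLp.norm_apply_le u i

/-- A bound of a sesquilinear form from a uniform bound of its terms. -/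
theorem Matrix.norm_inner_toEuclideanLin_le (M : Matrix ι ι ℂ) (u v : EuclideanSpace ℂ ι) {K : ℝ}
    (h : ∀ i j, ‖u i‖ * ‖M i j‖ * ‖v j‖ ≤ K) :
    ‖⟪u, Matrix.toEuclideanLin M v⟫_ℂ‖ ≤ (Fintype.card ι : ℝ) ^ 2 * K := by
  rw [Matrix.inner_toEuclideanLin]
  calc _ ≤ ∑ i : ι, ∑ j : ι, K := by
        refine norm_sum_le_of_le _ fun i _ => norm_sum_le_of_le _ fun j _ => ?_
        rw [norm_mul, norm_mul, RCLike.norm_conj]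
        exact h i j
    _ = _ := by
      simp only [Finset.sum_const, Finset.card_univ, nsmul_eq_mul]
      ring

/-- If the `i`-th coordinate is small on a subspace, then so is the projection of `e_i`. -/
theorem EuclideanSpace.exists_short_component (K : Submodule ℂ (EuclideanSpace ℂ ι)) {ε : ℝ}
    (hε : 0 ≤ ε) {i : ι}
    (h : ∀ u ∈ K, ‖u i‖ ≤ ε * ‖u‖) :
    ∃ p ∈ K, ∃ a ∈ Kᗮ, EuclideanSpace.single i 1 = p + a ∧ ‖p‖ ≤ ε ∧ ‖a‖ ≤ 1 := by
  obtain ⟨p, hp, a, ha, hpa⟩ :=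
    K.exists_add_mem_mem_orthogonal (EuclideanSpace.single i (1 : ℂ))
  have hort : ⟪p, a⟫_ℂ = 0 := (Submodule.mem_orthogonal _ _).1 ha p hp
  refine ⟨p, hp, a, ha, hpa, ?_, ?_⟩
  -- As `p` is the projection of `e_i`, `‖p‖²` equals `‖p i‖`, which is at most `ε * ‖p‖`.
  · have h1 : ⟪p, EuclideanSpace.single i (1 : ℂ)⟫_ℂ = (‖p‖ : ℂ) ^ 2 := by
      rw [hpa, inner_add_right, hort, add_zero]
      exact inner_self_eq_norm_sq_to_K p
    have h2 : ‖p‖ ^ 2 = ‖p i‖ := by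
      have := congrArg norm h1
      simpa [EuclideanSpace.inner_single_right] using this.symm
    by_cases hp0 : ‖p‖ = 0
    · rwa [hp0]
    · have h3 := h p hp
      rw [← h2, sq] at h3
      exact le_of_mul_le_mul_right h3 (lt_of_le_of_ne (norm_nonneg _) (Ne.symm hp0))
  · have h1 := norm_add_sq_eq_norm_sq_add_norm_sq_of_inner_eq_zero _ _ hort
    rw [← hpa] at h1
    simp only [PiLp.norm_single, norm_one, mul_one] at h1
    nlinarith [norm_nonneg a, norm_nonneg p]

/-- Perturbation theorem for matrices whose column and row spaces are nearly supported on
the index set `s`, along directions vanishing on `s × s`. -/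
theorem QHankel.nuclearNorm_lt_add (X E : Matrix ι ι ℂ) (s : ι → Prop) {ε e : ℝ} (hε : 0 ≤ ε)
    (hr : ∀ u ∈ LinearMap.range (Matrix.toEuclideanLin X), ∀ i, ¬ s i → ‖u i‖ ≤ ε * ‖u‖)
    (hk : ∀ u ∈ (LinearMap.ker (Matrix.toEuclideanLin X))ᗮ, ∀ i, ¬ s i → ‖u i‖ ≤ ε * ‖u‖)
    (he : 0 < e) (hE : ∀ i j, ‖E i j‖ ≤ e) (hEs : ∀ i j, s i → s j → E i j = 0)
    {i₀ j₀ : ι} (hi₀ : ¬ s i₀) (hj₀ : ¬ s j₀) (he₀ : ‖E i₀ j₀‖ = e)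
    (hsmall : ε * ((Fintype.card ι : ℝ) ^ 3 + 2 * (Fintype.card ι : ℝ) ^ 2) < 1) :
    QHankel.nuclearNorm X < QHankel.nuclearNorm (X + E) := by
  set N : ℝ := (Fintype.card ι : ℝ) with hN
  obtain ⟨p, hp, a, ha, hpa, hpε, ha1⟩ := EuclideanSpace.exists_short_component _ hε
    fun u hu => hr u hu i₀ hi₀
  obtain ⟨q, hq, b, hb, hqb, hqε, hb1⟩ := EuclideanSpace.exists_short_component _ hε
    fun u hu => hk u hu j₀ hj₀
  rw [Submodule.orthogonal_orthogonal] at hb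
  rw [QHankel.nuclearNorm_eq_sum_fin, QHankel.nuclearNorm_eq_sum_fin, map_add]
  have hgen : ∀ u v : EuclideanSpace ℂ ι,
      ‖⟪u, Matrix.toEuclideanLin E v⟫_ℂ‖ ≤ N ^ 2 * (‖u‖ * e * ‖v‖) := fun u v => by
    refine Matrix.norm_inner_toEuclideanLin_le _ _ _ fun i j => ?_
    gcongr
    · exact EuclideanSpace.norm_coord_le u i
    · exact hE i j
    · exact EuclideanSpace.norm_coord_le v j
  have hN0 : 0 ≤ N := Nat.cast_nonneg _
  refine LinearMap.sum_singularValues_lt_add _ _ (finrank_euclideanSpace) ha1 hb1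
    (fun v => (Submodule.mem_orthogonal' _ _).1 ha _ ⟨v, rfl⟩) hb
    (δ := N ^ 2 * (ε * e)) (by positivity) ?_ ?_
  -- Every nonzero entry of `E` has an index outside `s`, where a coordinate of `u` or `v` supplies
  -- the factor `ε`.
  · intro u hu v hv
    have := Matrix.norm_inner_toEuclideanLin_le E u v (K := ε * e * (‖u‖ * ‖v‖)) fun i j => by
      by_cases hi : s i
      · by_cases hj : s j
        · rw [hEs i j hi hj]
          simp only [norm_zero, mul_zero, zero_mul]
          positivity
        · calc _ ≤ ‖u‖ * e * (ε * ‖v‖) := by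
                gcongr
                · exact EuclideanSpace.norm_coord_le u i
                · exact hE i j
                · exact hk v hv j hj
            _ = _ := by ring
      · calc _ ≤ (ε * ‖u‖) * e * ‖v‖ := by
              gcongr
              · exact hr u hu i hi
              · exact hE i j
              · exact EuclideanSpace.norm_coord_le v j
          _ = _ := by ring
    calc _ ≤ _ := this
      _ = _ := by ring
  · have h0 : ⟪EuclideanSpace.single i₀ (1 : ℂ),
        Matrix.toEuclideanLin E (EuclideanSpace.single j₀ (1 : ℂ))⟫_ℂ = E i₀ j₀ := by
      simp [EuclideanSpace.inner_single_left]
    -- The first two terms cost `N² ε e` each; with `N * δ = N³ ε e` this is the constant in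
    -- `hsmall`.
    have hdec : E i₀ j₀ = ⟪p, Matrix.toEuclideanLin E (EuclideanSpace.single j₀ (1 : ℂ))⟫_ℂ +
        (⟪a, Matrix.toEuclideanLin E q⟫_ℂ + ⟪a, Matrix.toEuclideanLin E b⟫_ℂ) := by
      rw [← inner_add_right, ← map_add, ← hqb, ← inner_add_left, ← hpa, h0]
    have h1 : ‖⟪p, Matrix.toEuclideanLin E (EuclideanSpace.single j₀ (1 : ℂ))⟫_ℂ‖ ≤
        N ^ 2 * (ε * e * 1) := by
      refine (hgen _ _).trans ?_
      gcongr
      simp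
    have h2 : ‖⟪a, Matrix.toEuclideanLin E q⟫_ℂ‖ ≤ N ^ 2 * (1 * e * ε) := by
      refine (hgen _ _).trans ?_
      gcongr
    have h3 := congrArg norm hdec
    rw [he₀] at h3
    have h4 := norm_add_le ⟪p, Matrix.toEuclideanLin E (EuclideanSpace.single j₀ (1 : ℂ))⟫_ℂ
      (⟪a, Matrix.toEuclideanLin E q⟫_ℂ + ⟪a, Matrix.toEuclideanLin E b⟫_ℂ)
    have h5 := norm_add_le ⟪a, Matrix.toEuclideanLin E q⟫_ℂ ⟪a, Matrix.toEuclideanLin E b⟫_ℂ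
    have h6 := mul_lt_mul_of_pos_right hsmall he
    rw [← hN]
    nlinarith

end Matrices

/-! ### Multi-indices and degrees. -/

namespace QHankel

theorem deg_add {m : ℕ} (α β : Fin m → ℕ) : deg (α + β) = deg α + deg β :=
  Finset.sum_add_distrib

theorem exists_le_deg_eq {m : ℕ} (γ : Fin m → ℕ) {k : ℕ} (hk : k ≤ deg γ) :
    ∃ α β : Fin m → ℕ, α + β = γ ∧ deg α = k := by
  induction k with
  | zero => exact ⟨0, γ, zero_add γ, by simp [deg]⟩
  | succ k ih =>
    obtain ⟨α, β, h, hα⟩ := ih (by omega)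
    have hβ : deg β ≠ 0 := by
      have := deg_add α β
      rw [h] at this
      omega
    obtain ⟨i, -, hi⟩ := Finset.exists_ne_zero_of_sum_ne_zero hβ
    refine ⟨α + Pi.single i 1, β - Pi.single i 1, ?_, ?_⟩
    · rw [← h]
      funext j
      by_cases hj : j = i
      · subst hj
        simp only [Pi.add_apply, Pi.sub_apply, Pi.single_eq_same]
        omega
      · simp [Pi.single_eq_of_ne hj]
    · rw [deg_add, hα]
      simp [deg]

theorem mem_trgset_add {m d : ℕ} {γ : Fin m → ℕ} (h : γ ∈ trgset m d + trgset m d) :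
    deg γ ≤ 2 * d := by
  obtain ⟨α, hα, β, hβ, rfl⟩ := Finset.mem_add.1 h
  rw [mem_trgset] at hα hβ
  rw [deg_add]
  omega

/-- Stars and bars: a slack variable turns degree at most `k` in `m` variables into degree exactly
`k` in `m + 1`. -/
theorem choose_le_card_trgset (m k : ℕ) : (m + k).choose m ≤ (trgset m k).card := by
  have h := Finset.card_finsuppAntidiag_nat_eq_choose (s := (Finset.univ : Finset (Fin (m + 1)))) k
  have h2 : (m + k).choose m =
      ((Finset.univ : Finset (Fin (m + 1))).finsuppAntidiag k).card := by
    rw [h, Finset.card_univ, Fintype.card_fin, Nat.add_right_comm, Nat.add_sub_cancel,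
      Nat.choose_symm_add]
  rw [h2]
  refine Finset.card_le_card_of_injOn (fun f i => f i.castSucc) (fun f hf => ?_)
    fun f hf g hg hfg => ?_
  · have hf' := (Finset.mem_finsuppAntidiag.1 (Finset.mem_coe.1 hf)).1
    rw [Fin.sum_univ_castSucc] at hf'
    refine Finset.mem_coe.2 (mem_trgset.2 ?_)
    simp only [deg]
    omega
  · have hf' := (Finset.mem_finsuppAntidiag.1 (Finset.mem_coe.1 hf)).1
    have hg' := (Finset.mem_finsuppAntidiag.1 (Finset.mem_coe.1 hg)).1
    rw [Fin.sum_univ_castSucc] at hf' hg'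
    have hfg' : ∀ i : Fin m, f i.castSucc = g i.castSucc := fun i => congrFun hfg i
    simp_rw [hfg'] at hf'
    ext i
    refine Fin.lastCases ?_ hfg' i
    omega

/-- A set of multi-indices which contains all multi-indices of degree `< d₀` and is no larger than
the set of those of degree `≤ k` lies in the latter, if its degrees are at most `d₀`. -/
theorem deg_le_of_card_le {m d₀ k : ℕ} {D : Finset (Fin m → ℕ)}
    (hlow : ∀ α : Fin m → ℕ, deg α < d₀ → α ∈ D) (hD : D ⊆ trgset m d₀)
    (hcard : D.card ≤ (m + k).choose m) {α : Fin m → ℕ} (hα : α ∈ D) : deg α ≤ k := by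
  by_contra! hlt
  have hd₀ := mem_trgset.1 (hD hα)
  -- An element of degree above `k` forces `k < d₀`, so `D` contains all degrees up to `k` and one
  -- more index.
  have hss : trgset m k ⊂ D := by
    refine (Finset.ssubset_iff_of_subset fun β hβ => hlow β ?_).2
      ⟨α, hα, fun h => by have := mem_trgset.1 h; omega⟩
    have := mem_trgset.1 hβ
    omega
  have := Finset.card_lt_card hss
  have := choose_le_card_trgset m k
  omega

/-! ### Monomials and Vandermonde matrices of shrinking points. -/

theorem monom_smul {m : ℕ} (ρ : ℂ) (z : Fin m → ℂ) (α : Fin m → ℕ) :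
    monom (ρ • z) α = ρ ^ deg α * monom z α := by
  simp [monom, deg, mul_pow, Finset.prod_mul_distrib, Finset.prod_pow_eq_pow_sum]

theorem monom_add {m : ℕ} (z : Fin m → ℂ) (α β : Fin m → ℕ) :
    monom z (α + β) = monom z α * monom z β := by
  simp [monom, pow_add, Finset.prod_mul_distrib]

theorem vandermonde_mulVec {m r : ℕ} (A : Finset (Fin m → ℕ)) (z : Fin r → Fin m → ℂ)
    (x : Fin r → ℂ) (α : A) :
    (vandermonde A z).mulVec x α = ∑ k, monom (z k) α * x k := rfl

theorem IsIndependent.exists_leftInverse {m r : ℕ} {D : Finset (Fin m → ℕ)}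
    {y : Fin r → Fin m → ℂ} (h : IsIndependent D y) :
    ∃ g : (D → ℂ) →ₗ[ℂ] (Fin r → ℂ), ∀ x, g ((vandermonde D y).mulVec x) = x := by
  have hli : LinearIndependent ℂ (vandermonde D y).col := by
    rw [linearIndependent_iff_card_eq_finrank_span, Fintype.card_fin, Set.finrank,
      ← Matrix.rank_eq_finrank_span_cols]
    exact h.symm
  have hinj := Matrix.mulVec_injective_iff.2 hli
  obtain ⟨g, hg⟩ := (vandermonde D y).mulVecLin.exists_leftInverse_of_injective
    (LinearMap.ker_eq_bot.2 hinj)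
  exact ⟨g, fun x => LinearMap.congr_fun hg x⟩

/-- As the points shrink, the column space of their quasi-Vandermonde matrix concentrates on the
rows of low degree. -/
theorem IsIndependent.exists_high_coord_le {m r k : ℕ} {D : Finset (Fin m → ℕ)}
    {y : Fin r → Fin m → ℂ} (h : IsIndependent D y) (hD : ∀ α ∈ D, deg α ≤ k)
    (A : Finset (Fin m → ℕ)) :
    ∃ C : ℝ, 0 ≤ C ∧ ∀ ρ : ℝ, 0 < ρ → ρ ≤ 1 → ∀ (x : Fin r → ℂ) (B : ℝ), 0 ≤ B →
      (∀ β ∈ D, ‖∑ j, monom ((ρ : ℂ) • y j) β * x j‖ ≤ B) →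
      ∀ α ∈ A, k < deg α → ‖∑ j, monom ((ρ : ℂ) • y j) α * x j‖ ≤ C * ρ * B := by
  obtain ⟨g, hg⟩ := h.exists_leftInverse
  -- Row `α` is a fixed combination of the rows in `D`, computed at the unscaled points, so `C`
  -- depends on neither `ρ` nor `x`.
  let f : (Fin m → ℕ) → (D → ℂ) →ₗ[ℂ] ℂ := fun α =>
    (∑ j, (monom (y j) α) • LinearMap.proj (R := ℂ) (φ := fun _ : Fin r => ℂ) j) ∘ₗ g
  have hf : ∀ α x, f α ((vandermonde D y).mulVec x) = ∑ j, monom (y j) α * x j := fun α x => by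
    simp [f, hg]
  let F : (Fin m → ℕ) → (D → ℂ) →L[ℂ] ℂ := fun α => LinearMap.toContinuousLinearMap (f α)
  refine ⟨∑ α ∈ A, ‖F α‖, Finset.sum_nonneg fun _ _ => norm_nonneg _, ?_⟩
  intro ρ hρ hρ1 x B hB hx α hα hαk
  have hscale : ∀ β, ∑ j, monom ((ρ : ℂ) • y j) β * x j =
      (ρ : ℂ) ^ deg β * ∑ j, monom (y j) β * x j := fun β => by
    simp_rw [monom_smul, mul_assoc, Finset.mul_sum]
  have hw : ‖(ρ : ℂ) ^ deg α • (vandermonde D y).mulVec x‖ ≤ ρ * B := by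
    refine (pi_norm_le_iff_of_nonneg (by positivity)).2 fun β => ?_
    have hβ := hx β β.2
    rw [hscale, norm_mul, norm_pow, Complex.norm_real, Real.norm_of_nonneg hρ.le] at hβ
    rw [Pi.smul_apply, vandermonde_mulVec, smul_eq_mul, norm_mul, norm_pow, Complex.norm_real,
      Real.norm_of_nonneg hρ.le]
    have hle := hD β β.2
    -- Rescaling from degree `deg β ≤ k` to `deg α > k` leaves at least one factor `ρ`.
    obtain ⟨t, ht⟩ := Nat.exists_eq_add_of_lt (hle.trans_lt hαk)
    calc ρ ^ deg α * ‖∑ j, monom (y j) β * x j‖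
        = ρ ^ (t + 1) * (ρ ^ deg β.1 * ‖∑ j, monom (y j) β * x j‖) := by
          rw [ht]
          ring
      _ ≤ ρ * B := by
          gcongr
          exact pow_le_of_le_one hρ.le hρ1 (Nat.succ_ne_zero t)
  rw [hscale, ← hf, ← smul_eq_mul, ← map_smul]
  calc ‖F α ((ρ : ℂ) ^ deg α • (vandermonde D y).mulVec x)‖
      ≤ ‖F α‖ * ‖(ρ : ℂ) ^ deg α • (vandermonde D y).mulVec x‖ := (F α).le_opNorm _
    _ ≤ (∑ α ∈ A, ‖F α‖) * (ρ * B) := by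
        gcongr
        exact Finset.single_le_sum (f := fun α => ‖F α‖) (fun _ _ => norm_nonneg _) hα
    _ = _ := by ring

/-! ### Column and row spaces of the canonical completion. -/

/-- The canonical completion is `V diag(c) Vᵀ`. -/
theorem completion_canonicalCompletion_apply {m r : ℕ} (A : Finset (Fin m → ℕ)) (c : Fin r → ℂ)
    (z : Fin r → Fin m → ℂ) (α β : A) :
    completion (initialArray A c z) (canonicalCompletion A c z) α β =
      ∑ j, monom (z j) α * (c j * monom (z j) β) := by
  have h : completion (initialArray A c z) (canonicalCompletion A c z) α β =
      expArray c z (α.1 + β.1) := by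
    simp only [completion, hankel, Matrix.of_apply, fillIn, initialArray, canonicalCompletion]
    split_ifs <;> rfl
  rw [h, expArray]
  refine Finset.sum_congr rfl fun j _ => ?_
  rw [monom_add]
  ring

/-- The weights `c` are absorbed into `x`; this makes later bounds uniform in `c`. -/
theorem exists_coord_eq_of_mem_range {m r : ℕ} (A : Finset (Fin m → ℕ)) (c : Fin r → ℂ)
    (z : Fin r → Fin m → ℂ) {u : EuclideanSpace ℂ A}
    (hu : u ∈ LinearMap.range (Matrix.toEuclideanLin
      (completion (initialArray A c z) (canonicalCompletion A c z)))) :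
    ∃ x : Fin r → ℂ, ∀ α : A, u α = ∑ j, monom (z j) α * x j := by
  obtain ⟨v, rfl⟩ := hu
  refine ⟨fun j => ∑ β : A, c j * monom (z j) β * v β, fun α => ?_⟩
  rw [Matrix.toLpLin_apply]
  simp only [Matrix.mulVec, dotProduct, completion_canonicalCompletion_apply, Finset.sum_mul,
    Finset.mul_sum]
  rw [Finset.sum_comm]
  exact Finset.sum_congr rfl fun j _ => Finset.sum_congr rfl fun β _ => by ring

theorem completion_transpose {m : ℕ} {A : Finset (Fin m → ℕ)} (h : A → ℂ)
    (p : ↥((A + A) \ A) → ℂ) : (completion h p).transpose = completion h p := by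
  ext α β
  simp only [completion, hankel, Matrix.transpose_apply, Matrix.of_apply, add_comm]

end QHankel

/-- The row space of a complex symmetric matrix is the conjugate of its column space. -/
theorem Matrix.exists_conj_mem_range_of_mem_orthogonal_ker {ι : Type*} [Fintype ι] [DecidableEq ι]
    {X : Matrix ι ι ℂ} (hX : X.transpose = X) {v : EuclideanSpace ℂ ι}
    (hv : v ∈ (LinearMap.ker (Matrix.toEuclideanLin X))ᗮ) :
    ∃ u ∈ LinearMap.range (Matrix.toEuclideanLin X), ∀ i, u i = (starRingEnd ℂ) (v i) := by
  rw [LinearMap.orthogonal_ker, ← Matrix.toEuclideanLin_conjTranspose_eq_adjoint] at hv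
  obtain ⟨w, rfl⟩ := hv
  refine ⟨_, ⟨WithLp.toLp 2 (fun i => (starRingEnd ℂ) (w i)), rfl⟩, fun i => ?_⟩
  simp only [Matrix.toLpLin_apply, Matrix.mulVec, dotProduct, Matrix.conjTranspose_apply, map_sum,
    map_mul]
  refine Finset.sum_congr rfl fun j _ => ?_
  have : X j i = X i j := congrFun (congrFun hX i) j
  simp [this]

namespace QHankel

theorem high_coord_le {m r k : ℕ} {D A : Finset (Fin m → ℕ)} (hDA : D ⊆ A)
    (c : Fin r → ℂ) (z : Fin r → Fin m → ℂ) {ε : ℝ}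
    (hz : ∀ (x : Fin r → ℂ) (B : ℝ), 0 ≤ B → (∀ β ∈ D, ‖∑ j, monom (z j) β * x j‖ ≤ B) →
      ∀ α ∈ A, k < deg α → ‖∑ j, monom (z j) α * x j‖ ≤ ε * B)
    {u : EuclideanSpace ℂ A}
    (hu : u ∈ LinearMap.range (Matrix.toEuclideanLin
      (completion (initialArray A c z) (canonicalCompletion A c z))))
    (α : A) (hα : ¬ deg α.1 ≤ k) : ‖u α‖ ≤ ε * ‖u‖ := by
  obtain ⟨x, hx⟩ := exists_coord_eq_of_mem_range A c z hu
  rw [hx]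
  refine hz x ‖u‖ (norm_nonneg _) (fun β hβ => ?_) α α.2 (not_le.1 hα)
  have := EuclideanSpace.norm_coord_le u ⟨β, hDA hβ⟩
  rwa [hx] at this

theorem high_coord_le_of_orthogonal_ker {m r k : ℕ} {D A : Finset (Fin m → ℕ)} (hDA : D ⊆ A)
    (c : Fin r → ℂ) (z : Fin r → Fin m → ℂ) {ε : ℝ}
    (hz : ∀ (x : Fin r → ℂ) (B : ℝ), 0 ≤ B → (∀ β ∈ D, ‖∑ j, monom (z j) β * x j‖ ≤ B) →
      ∀ α ∈ A, k < deg α → ‖∑ j, monom (z j) α * x j‖ ≤ ε * B)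
    {v : EuclideanSpace ℂ A}
    (hv : v ∈ (LinearMap.ker (Matrix.toEuclideanLin
      (completion (initialArray A c z) (canonicalCompletion A c z))))ᗮ)
    (α : A) (hα : ¬ deg α.1 ≤ k) : ‖v α‖ ≤ ε * ‖v‖ := by
  obtain ⟨u, hu, huv⟩ :=
    Matrix.exists_conj_mem_range_of_mem_orthogonal_ker (completion_transpose _ _) hv
  have h1 := high_coord_le hDA c z hz hu α hα
  have h2 : ‖u‖ = ‖v‖ := by simp [EuclideanSpace.norm_eq, huv]
  rwa [huv, RCLike.norm_conj, h2] at h1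

/-- The canonical completion has strictly smaller nuclear norm than any other completion. -/
theorem nuclearNorm_canonicalCompletion_lt {m d r k : ℕ} (hk : 2 * k + 1 ≤ d)
    {A D : Finset (Fin m → ℕ)}
    (hA : A = trgset m d) (hDA : D ⊆ A) (c : Fin r → ℂ) (z : Fin r → Fin m → ℂ)
    {ε : ℝ} (hε : 0 ≤ ε)
    (hz : ∀ (x : Fin r → ℂ) (B : ℝ), 0 ≤ B → (∀ β ∈ D, ‖∑ j, monom (z j) β * x j‖ ≤ B) →
      ∀ α ∈ A, k < deg α → ‖∑ j, monom (z j) α * x j‖ ≤ ε * B)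
    (hsmall : ε * ((A.card : ℝ) ^ 3 + 2 * (A.card : ℝ) ^ 2) < 1)
    {q : ↥((A + A) \ A) → ℂ}
    (hq : q ≠ canonicalCompletion A c z) :
    nuclearNorm (completion (initialArray A c z)
        (canonicalCompletion A c z)) <
      nuclearNorm (completion (initialArray A c z) q) := by
  have hmem : ∀ {α}, α ∈ A ↔ deg α ≤ d := by
    rw [hA]
    exact mem_trgset
  let h := initialArray A c z
  let p := canonicalCompletion A c z
  obtain ⟨γ₁, hγ₁⟩ := Function.ne_iff.1 hq
  obtain ⟨γ, -, hγ⟩ := Finset.exists_max_image Finset.univ (fun γ => ‖q γ - p γ‖)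
    ⟨γ₁, Finset.mem_univ _⟩
  have hpos : 0 < ‖q γ - p γ‖ :=
    (norm_pos_iff.2 (sub_ne_zero.2 hγ₁)).trans_le (hγ γ₁ (Finset.mem_univ _))
  have hEin : ∀ α β : A, (hαβ : α.1 + β.1 ∈ A) → (completion h q - completion h p) α β = 0 :=
    fun α β hαβ => by simp [completion, hankel, fillIn, hαβ]
  have hEout : ∀ α β : A, (hαβ : α.1 + β.1 ∉ A) → (completion h q - completion h p) α β =
      q ⟨α.1 + β.1, Finset.mem_sdiff.2 ⟨Finset.add_mem_add α.2 β.2, hαβ⟩⟩ -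
      p ⟨α.1 + β.1, Finset.mem_sdiff.2 ⟨Finset.add_mem_add α.2 β.2, hαβ⟩⟩ :=
    fun α β hαβ => by simp [completion, hankel, fillIn, hαβ]
  have hγ2 := mem_trgset_add (hA ▸ (Finset.mem_sdiff.1 γ.2).1 : γ.1 ∈ trgset m d + trgset m d)
  have hγd : d < deg γ.1 := by
    by_contra! hle
    exact (Finset.mem_sdiff.1 γ.2).2 (hmem.2 hle)
  -- This choice keeps both degrees in `[k + 1, d]`, because `2k + 2 ≤ deg γ ≤ 2d`.
  obtain ⟨α, β, hαβ, hα⟩ := exists_le_deg_eq γ.1 (k := max (k + 1) (deg γ.1 - d)) (by omega)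
  have hdeg := deg_add α β
  rw [hαβ] at hdeg
  have key := nuclearNorm_lt_add (completion h p) (completion h q - completion h p)
    (fun α => deg α.1 ≤ k) hε
    (fun u hu i hi => high_coord_le hDA c z hz hu i hi)
    (fun v hv i hi => high_coord_le_of_orthogonal_ker hDA c z hz hv i hi) hpos
    (fun i j => by
      by_cases hij : i.1 + j.1 ∈ A
      · rw [hEin i j hij, norm_zero]
        exact hpos.le
      · rw [hEout i j hij]
        exact hγ _ (Finset.mem_univ _))
    (fun i j hi hj => hEin i j (hmem.2 (by rw [deg_add]; omega)))
    (i₀ := ⟨α, hmem.2 (by omega)⟩) (j₀ := ⟨β, hmem.2 (by omega)⟩)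
    (by simp only; omega) (by simp only; omega)
    (by
      have hnot : α + β ∉ A := hαβ ▸ (Finset.mem_sdiff.1 γ.2).2
      rw [hEout _ _ hnot]
      simp only [hαβ])
    (by rwa [Fintype.card_coe])
  rwa [add_sub_cancel] at key

end QHankel

theorem theorem3 (m d r : ℕ)
    (hr : r ≤ (m + (d - 1) / 2).choose m)
    (y : Fin r → Fin m → ℂ)
    (hy : ∃ (d₀ : ℕ) (D : Finset (Fin m → ℕ)), d₀ + 1 ≤ d ∧
      (∀ α : Fin m → ℕ, QHankel.deg α < d₀ → α ∈ D) ∧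
      D ⊆ QHankel.trgset m d₀ ∧ D.card = r ∧ QHankel.IsIndependent D y) :
    ∃ ρ₀ : ℝ, 0 < ρ₀ ∧ ∀ ρ : ℝ, 0 < ρ → ρ < ρ₀ →
      ∀ c : Fin r → ℂ, (∀ k, c k ≠ 0) →
        QHankel.nuclearNormSolutions
            (QHankel.initialArray (QHankel.trgset m d) c (fun k => (ρ : ℂ) • y k)) =
          {QHankel.canonicalCompletion (QHankel.trgset m d) c (fun k => (ρ : ℂ) • y k)} := by
  obtain ⟨d₀, D, hd, hlow, hD, hcard, hind⟩ := hy
  have hDk : ∀ α ∈ D, QHankel.deg α ≤ (d - 1) / 2 := fun α hα =>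
    QHankel.deg_le_of_card_le hlow hD (hcard.le.trans hr) hα
  have hDA : D ⊆ QHankel.trgset m d := fun α hα => QHankel.mem_trgset.2 (by
    have := hDk α hα
    omega)
  obtain ⟨C, hC, hbound⟩ := hind.exists_high_coord_le hDk (QHankel.trgset m d)
  set N : ℝ := ((QHankel.trgset m d).card : ℝ) with hN
  set K : ℝ := C * (N ^ 3 + 2 * N ^ 2) with hK
  have hK0 : 0 ≤ K := by positivity
  -- `K` gives the smallness condition; the extra `1` also ensures `ρ ≤ 1`.
  refine ⟨(K + 1)⁻¹, by positivity, fun ρ hρ hρlt c _ => ?_⟩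
  have hρK : ρ * (K + 1) < 1 := by
    rwa [← one_div, lt_div_iff₀ (by positivity)] at hρlt
  have hρ1 : ρ ≤ 1 := by nlinarith
  have hlt : ∀ q, q ≠ QHankel.canonicalCompletion (QHankel.trgset m d) c
      (fun k => (ρ : ℂ) • y k) → _ := fun q hq =>
    QHankel.nuclearNorm_canonicalCompletion_lt (k := (d - 1) / 2) (by omega) rfl hDA c
      (fun k => (ρ : ℂ) • y k) (ε := C * ρ) (by positivity) (hbound ρ hρ hρ1) (by nlinarith) hq
  ext p
  rw [Set.mem_singleton_iff]
  constructor
  · intro hp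
    by_contra hne
    exact absurd (hp _) (not_le.2 (hlt p hne))
  · rintro rfl q
    by_cases hq : q = QHankel.canonicalCompletion (QHankel.trgset m d) c
        (fun k => (ρ : ℂ) • y k)
    · rw [hq]
    · exact (hlt q hq).le
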